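/- All vocabularies are finitary (relation and function symbols of finite arity; constants are $0$-ary function symbols), and structures may have empty universe. An abstract elementary class (AEC) is a pair $\mathcal K=(K,\le_{\mathcal K})$, where $K$ is a class of structures in a fixed vocabulary $\tau=\tau(\mathcal K)$ and $\le_{\mathcal K}$ is a partial order on $K$ such that: $M\le_{\mathcal K}N$ implies $M\subseteq N$; $K$ and $\le_{\mathcal K}$ are closed under isomorphisms; (coherence) if $M_0,M_1,M_2\in K$, $M_0\subseteq M_1\le_{\mathcal K}M_2$ and $M_0\le_{\mathcal K}M_2$, then $M_0\le_{\mathcal K}M_1$; (chains) if $\delta$ is a limit ordinal, $\langle M_i:i<\delta\rangle$ is $\le_{\mathcal K}$-increasing and $M=\bigcup_{i<\delta}M_i$, then $M\in K$, $M_0\le_{\mathcal K}M$, and $M\le_{\mathcal K}N$ whenever $N\in K$ and $M_i\le_{\mathcal K}N$ for all $i<\delta$; (LST) there is a cardinal $\lambda\ge|\tau|+\aleph_0$ such that for all $N\in K$ and $A\subseteq|N|$ there is $M\le_{\mathcal K}N$ with $A\subseteq|M|$ and $\|M\|\le|A|+\lambda$. The least such $\lambda$ is denoted $\mathrm{LS}(\mathcal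 K)$. For $N\in K$ and $A\subseteq|N|$, let $\mathrm{cl}^N(A)=\bigcap\{|N_0| : N_0\le_{\mathcal K}N,\ A\subseteq|N_0|\}$, viewed as a substructure of $N$. The AEC $\mathcal K$ has intersections if $\mathrm{cl}^N(A)\le_{\mathcal K}N$ for all $N\in K$ and $A\subseteq|N|$. In that case, for $M,N\in K$ and finite sequences $\mathbf a$ in $M$ and $\mathbf b$ in $N$, write $(\mathbf a,M)\equiv(\mathbf b,N)$ if there is an isomorphism $f:\mathrm{cl}^M(\mathbf a)\cong\mathrm{cl}^N(\mathbf b)$ with $f(\mathbf a)=\mathbf b$, and let $\mathbf D(\mathcal K)$ be the set of $\equiv$-classes. A functorial expansion of $\mathcal K$ is a class $K^+$ of structures in a vocabulary $\tau^+\supseteq\tau$ such that the reduct map $M^+\mapsto M^+\upharpoonright\tau$ is a bijection from $K^+$ onto $K$, every isomorphism $M^+\upharpoonright\tau\cong N^+\upharpoonright\tau$ with $M^+,N^+\in K^+$ is an isomorphism $M^+\cong N^+$, and $M^+\subseteq N^+$ whenever $M^+,N^+\in K^+$ and $M^+\upharpoonright\tau\le_{\mathcal K}N^+\upharpoonright\tau$.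 For an infinite cardinal $\kappa$, $\mathbb L_{\kappa,\omega}(Q)$ is the logic with conjunctions and disjunctions of fewer than $\kappa$ formulas, negation, the quantifiers $\forall x$ and $\exists x$ over single variables, and the quantifier $Qx$, "there exist uncountably many $x$". Corollary. Let $\mathcal K$ be an AEC with intersections and $\mathrm{LS}(\mathcal K)=\aleph_0$. Then there are a functorial expansion $K^+$ of $\mathcal K$, whose vocabulary $\tau^+$ is obtained from $\tau(\mathcal K)$ by adding countably many relation symbols of finite arity, and an $\mathbb L_{\aleph_1+|\mathbf D(\mathcal K)|^+,\,\omega}(Q)$-theory $T$ in the vocabulary $\tau^+$ such that $K^+$ is the class of models of $T$. -/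

import Mathlib

open FirstOrder Cardinal

universe u

namespace AECInter

open FirstOrder.Language

/-! ### Abstract elementary classes -/

/-- A class of `L`-structures whose universes are (possibly empty) sets, that is, types in
`Type u`. -/
abbrev StructureClass (L : FirstOrder.Language.{u, u}) : Type (u + 1) :=
  ∀ (M : Type u) [L.Structure M], Prop

/-- A class of `L`-structures with a relation `M ≤ N` between its members that refines being
a substructure. The relation is recorded by saying which substructures `S` of `N` satisfy
`S ≤ N`; no axioms are imposed here. -/
structure AbstractClass (L : FirstOrder.Language.{u, u}) where
  /-- the members of the class -/
  Mem : StructureClass L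
  /-- `Strong S`, for a substructure `S` of `N`, means `S ≤ N` -/
  Strong : ∀ {N : Type u} [L.Structure N], L.Substructure N → Prop

namespace AbstractClass

variable {L : FirstOrder.Language.{u, u}}

/-- For substructures `S`, `T` of an ambient structure: `S ⊆ T`, and `S`, seen as a
substructure of the structure `T`, satisfies `S ≤ T`. -/
def StrongIn (K : AbstractClass L) {N : Type u} [L.Structure N] (S T : L.Substructure N) : Prop :=
  S ≤ T ∧ K.Strong (S.comap T.subtype.toHom)

/-- `lam` witnesses the Löwenheim-Skolem-Tarski axiom. -/
def IsLST (K : AbstractClass L) (lam : Cardinal.{u}) : Prop :=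
  L.card + ℵ₀ ≤ lam ∧
    ∀ (N : Type u) [L.Structure N], K.Mem N → ∀ A : Set N,
      ∃ S : L.Substructure N, K.Strong S ∧ A ⊆ S ∧ #S ≤ #A + lam

/-- The axioms of abstract elementary classes. -/
structure IsAEC (K : AbstractClass L) : Prop where
  /-- the relation is between members of the class -/
  mem_of_strong : ∀ {N : Type u} [L.Structure N] (S : L.Substructure N),
    K.Strong S → K.Mem S ∧ K.Mem N
  /-- reflexivity -/
  refl : ∀ {N : Type u} [L.Structure N], K.Mem N → K.Strong (⊤ : L.Substructure N)
  /-- transitivity (antisymmetry is automatic) -/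
  trans : ∀ {N : Type u} [L.Structure N] (S T : L.Substructure N),
    K.StrongIn S T → K.Strong T → K.Strong S
  /-- the class is closed under isomorphism -/
  mem_iso : ∀ {M N : Type u} [L.Structure M] [L.Structure N], (M ≃[L] N) → K.Mem M → K.Mem N
  /-- the ordering is closed under isomorphism -/
  strong_iso : ∀ {M N : Type u} [L.Structure M] [L.Structure N] (e : M ≃[L] N)
    (S : L.Substructure M), K.Strong S → K.Strong (S.map e.toHom)
  /-- coherence -/
  coherence : ∀ {N : Type u} [L.Structure N] (S T : L.Substructure N),
    S ≤ T → K.Strong T → K.Strong S → K.StrongIn S T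
  /-- the union `M` of an increasing chain `(C i)_{i < δ}`, with `δ` a limit ordinal, is in the
  class and lies above the first member of the chain -/
  chain : ∀ {M : Type u} [L.Structure M] (δ : Ordinal.{u}), Order.IsSuccLimit δ →
    ∀ C : Ordinal.{u} → L.Substructure M,
      (∀ i j, i ≤ j → j < δ → K.StrongIn (C i) (C j)) →
      (∀ x : M, ∃ i < δ, x ∈ C i) → K.Mem M ∧ K.Strong (C 0)
  /-- smoothness: if every member of an increasing chain lies below `N`, so does its union `U` -/
  smooth : ∀ {N : Type u} [L.Structure N] (δ : Ordinal.{u}), Order.IsSuccLimit δ →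
    ∀ C : Ordinal.{u} → L.Substructure N,
      (∀ i j, i ≤ j → j < δ → K.StrongIn (C i) (C j)) → (∀ i < δ, K.Strong (C i)) →
      ∀ U : L.Substructure N, (∀ x : N, x ∈ U ↔ ∃ i < δ, x ∈ C i) → K.Strong U
  /-- the Löwenheim-Skolem-Tarski axiom -/
  lst : ∃ lam, K.IsLST lam

/-- The Löwenheim-Skolem-Tarski number: the least cardinal witnessing the LST axiom. -/
noncomputable def LS (K : AbstractClass L) : Cardinal.{u} := sInf {lam | K.IsLST lam}

/-- `K.cl A` is the intersection of all `S ≤ N` that contain the subset `A` of `N`. -/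
def cl (K : AbstractClass L) {N : Type u} [L.Structure N] (A : Set N) : L.Substructure N :=
  sInf {S | K.Strong S ∧ A ⊆ S}

theorem subset_cl (K : AbstractClass L) {N : Type u} [L.Structure N] (A : Set N) :
    A ⊆ K.cl A := fun _ hx => by
  refine Substructure.mem_sInf.2 fun S hS => hS.2 hx

/-- The class has intersections. -/
def HasIntersections (K : AbstractClass L) : Prop :=
  ∀ (N : Type u) [L.Structure N], K.Mem N → ∀ A : Set N, K.Strong (K.cl A)

/-- A pair `(a, M)` with `M` in the class and `a` a finite sequence in `M`. -/
structure Pointed (K : AbstractClass L) : Type (u + 1) where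
  /-- the structure -/
  M : Type u
  /-- its interpretation of the vocabulary -/
  [str : L.Structure M]
  /-- it belongs to the class -/
  mem : K.Mem M
  /-- the length of the sequence -/
  n : ℕ
  /-- the sequence -/
  a : Fin n → M

instance (K : AbstractClass L) (p : K.Pointed) : L.Structure p.M := p.str

/-- `(a, M) ≡ (b, N)`: some isomorphism of `cl(a)` onto `cl(b)` takes `a` to `b`. -/
def PEquiv (K : AbstractClass L) (p q : K.Pointed) : Prop :=
  ∃ (h : p.n = q.n) (f : K.cl (Set.range p.a) ≃[L] K.cl (Set.range q.a)),
    ∀ i : Fin p.n,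
      (f ⟨p.a i, K.subset_cl _ (Set.mem_range_self i)⟩ : q.M) = q.a (Fin.cast h i)

theorem pequiv_equivalence (K : AbstractClass L) : Equivalence K.PEquiv where
  refl p := ⟨rfl, FirstOrder.Language.Equiv.refl L _, fun _ => rfl⟩
  symm := by
    rintro p q ⟨h, f, hf⟩
    refine ⟨h.symm, f.symm, fun i => ?_⟩
    have hi := hf (Fin.cast h.symm i)
    have : f.symm ⟨q.a i, K.subset_cl _ (Set.mem_range_self i)⟩ =
        ⟨p.a (Fin.cast h.symm i), K.subset_cl _ (Set.mem_range_self _)⟩ := by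
      apply f.injective
      rw [FirstOrder.Language.Equiv.apply_symm_apply]
      exact Subtype.ext hi.symm
    rw [this]
  trans := by
    rintro p q r ⟨h, f, hf⟩ ⟨h', g, hg⟩
    refine ⟨h.trans h', g.comp f, fun i => ?_⟩
    have hi : f ⟨p.a i, K.subset_cl _ (Set.mem_range_self i)⟩ =
        ⟨q.a (Fin.cast h i), K.subset_cl _ (Set.mem_range_self _)⟩ := Subtype.ext (hf i)
    rw [FirstOrder.Language.Equiv.comp_apply, hi]
    exact hg (Fin.cast h i)

/-- The collection of all equivalence classes of pairs `(a, M)`. -/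
def D (K : AbstractClass L) : Type (u + 1) :=
  Quotient (⟨K.PEquiv, K.pequiv_equivalence⟩ : Setoid K.Pointed)

end AbstractClass

/-- `Kp` is a functorial expansion of `K`, where `φ` is the inclusion of the vocabulary of `K` in
that of `Kp`. Here `φ.IsExpansionOn M` says that the `φ`-reduct of the given `L'`-structure on `M`
is the given `L`-structure on `M`. -/
structure IsFunctorialExpansion {L L' : FirstOrder.Language.{u, u}} (K : AbstractClass L) (φ : L →ᴸ L')
    (Kp : StructureClass L') : Prop where
  /-- the vocabulary of `K` is contained in that of `Kp` -/
  inclusion : φ.Injective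
  /-- reducts of members of `Kp` are in `K` -/
  reduct_mem : ∀ (M : Type u) [L.Structure M] [L'.Structure M] [φ.IsExpansionOn M],
    Kp M → K.Mem M
  /-- every member of `K` is the reduct of exactly one member of `Kp` -/
  existsUnique_expansion : ∀ (M : Type u) [L.Structure M], K.Mem M →
    ∃! _s : L'.Structure M, φ.IsExpansionOn M ∧ Kp M
  /-- isomorphisms between members of `K` are isomorphisms of their expansions -/
  iso : ∀ (M N : Type u) [L.Structure M] [L.Structure N] [L'.Structure M] [L'.Structure N]
    [φ.IsExpansionOn M] [φ.IsExpansionOn N], Kp M → Kp N →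
    ∀ f : M ≃[L] N, ∃ g : M ≃[L'] N, ∀ x, g x = f x
  /-- if `M ≤ N` (up to the identification of `M` with its image under `f`), then the expansion of
  `M` is a substructure of that of `N` -/
  mono : ∀ (M N : Type u) [L.Structure M] [L.Structure N] [L'.Structure M] [L'.Structure N]
    [φ.IsExpansionOn M] [φ.IsExpansionOn N], Kp M → Kp N →
    ∀ f : M ↪[L] N, K.Strong f.toHom.range → ∃ g : M ↪[L'] N, ∀ x, g x = f x

/-! ### The logic `L_{κ, ω}(Q)` -/

/-- Formulas of `L_{κ, ω}(Q)` with free variables among `n` variables: conjunctions and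
disjunctions of fewer than `κ` formulas, quantification over single variables, and the additional
quantifier `Q`. A quantifier binds the last of `n + 1` variables. -/
inductive QFormula (L : FirstOrder.Language.{u, u}) (κ : Cardinal.{u + 1}) : ℕ → Type (u + 1)
  | eq {n : ℕ} (s t : L.Term (Fin n)) : QFormula L κ n
  | rel {n k : ℕ} (R : L.Relations k) (ts : Fin k → L.Term (Fin n)) : QFormula L κ n
  | not {n : ℕ} (θ : QFormula L κ n) : QFormula L κ n
  | conj {n : ℕ} (ι : Type u) (hι : Cardinal.lift.{u + 1} #ι < κ) (θ : ι → QFormula L κ n) :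
      QFormula L κ n
  | disj {n : ℕ} (ι : Type u) (hι : Cardinal.lift.{u + 1} #ι < κ) (θ : ι → QFormula L κ n) :
      QFormula L κ n
  | all {n : ℕ} (θ : QFormula L κ (n + 1)) : QFormula L κ n
  | ex {n : ℕ} (θ : QFormula L κ (n + 1)) : QFormula L κ n
  | Q {n : ℕ} (θ : QFormula L κ (n + 1)) : QFormula L κ n

/-- Satisfaction in `L_{κ, ω}(Q)`; `Q x θ` means that uncountably many `x` satisfy `θ`. -/
def QFormula.Realize {L : FirstOrder.Language.{u, u}} {κ : Cardinal.{u + 1}} (M : Type u) [L.Structure M] :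
    {n : ℕ} → QFormula L κ n → (Fin n → M) → Prop
  | _, .eq s t, v => s.realize v = t.realize v
  | _, .rel R ts, v => Structure.RelMap R fun i => (ts i).realize v
  | _, .not θ, v => ¬ θ.Realize M v
  | _, .conj _ _ θ, v => ∀ i, (θ i).Realize M v
  | _, .disj _ _ θ, v => ∃ i, (θ i).Realize M v
  | _, .all θ, v => ∀ x : M, θ.Realize M (Fin.snoc v x)
  | _, .ex θ, v => ∃ x : M, θ.Realize M (Fin.snoc v x)
  | _, .Q θ, v => ¬ {x : M | θ.Realize M (Fin.snoc v x)}.Countable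

/-- `M` is a model of the set `T` of `L_{κ, ω}(Q)`-sentences. -/
def IsModel {L : FirstOrder.Language.{u, u}} {κ : Cardinal.{u + 1}} (T : Set (QFormula L κ 0))
    (M : Type u) [L.Structure M] : Prop :=
  ∀ θ ∈ T, θ.Realize M Fin.elim0

end AECInter

/-!
Let `K` be an abstract elementary class with intersections and Löwenheim-Skolem-Tarski number `ℵ₀`.
Its members are expanded by the relations "`y` is in the closure of `(a₀, …, aₘ₋₁)`", one for each
`m`. Closures are absolute between a member of `K` and its strong substructures
(`IsAEC.apply_mem_cl_iff`), and this makes the expansion functorial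
(`IsAEC.isFunctorialExpansion`). The theory `T` is the set of all sentences true in all expanded
members of `K`, and the point is that it has no other models.

In a model `M` of `T`, write `C a` for the set of all `y` that the relations assign to the finite
sequence `a`. Four kinds of sentences of `T` are used.
* `C a` contains `a` and is closed under functions, so it is a substructure (`clSub`).
* If `b` lies in `C a`, then `C b ⊆ C a` (`clRel_trans`).
* `C a` is countable (`countable_clRel`); this is where the quantifier `Q` is needed.
* `C a` is isomorphic to the expansion of a member of `K` (`exists_equiv_clSub`). The vocabulary is
  countable, so that by Scott's theorem (`exists_scott`) each countable structure with a finite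
  sequence in it is described, among countable structures, by one formula. It suffices to take the
  disjunction of these formulas over representatives of the classes in `D(K)`, with all quantifiers
  restricted to `C a` (`QFormula.relativize`, `QFormula.realize_relativize`).

Consequently, each `C a` is in `K`, and for `b` in `C a` the set `C b` is the closure of `b` in
`C a`, so `C b ≤ C a`. A directed system of this kind has its union in `K` and all its members are
strong in the union (`IsSystem.strongIn_hull`, `IsAEC.strong_of_tuples`): the axioms speak of chains
only, and the passage to directed systems is by induction on the cardinality. As `M` is the union
of the sets `C a`, it belongs to `K`, and `C a` is the closure of `a` in `M`.
-/

namespace AECInter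

open FirstOrder.Language

/-! ### Formulas of `L_{κ, ω}(Q)` -/

namespace QFormula

variable {L : FirstOrder.Language.{u, u}} {κ : Cardinal.{u + 1}} {n : ℕ}

theorem lift_mk_lt_of_countable (hκ : ℵ₀ < κ) (ι : Type u) [Countable ι] :
    Cardinal.lift.{u + 1} #ι < κ :=
  lt_of_le_of_lt (by simp [Cardinal.mk_le_aleph0]) hκ

/-- Conjunction of two formulas. -/
def and (hκ : ℵ₀ < κ) (θ ψ : QFormula L κ n) : QFormula L κ n :=
  .conj (ULift.{u} Bool) (lift_mk_lt_of_countable hκ _) fun b => bif b.down then θ else ψ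

/-- Implication. -/
def imp (hκ : ℵ₀ < κ) (θ ψ : QFormula L κ n) : QFormula L κ n :=
  .disj (ULift.{u} Bool) (lift_mk_lt_of_countable hκ _) fun b => bif b.down then .not θ else ψ

/-- The formula `∀ xₙ … xₙ₊ₖ₋₁, θ`. -/
def alls : (k : ℕ) → QFormula L κ (n + k) → QFormula L κ n
  | 0, θ => θ
  | k + 1, θ => alls k (.all (n := n + k) θ)

/-- The universal closure of a formula. -/
def close : (k : ℕ) → QFormula L κ k → QFormula L κ 0
  | 0, θ => θ
  | k + 1, θ => close k (.all θ)

variable {M : Type u} [L.Structure M]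

@[simp]
theorem realize_and (hκ : ℵ₀ < κ) (θ ψ : QFormula L κ n) (v : Fin n → M) :
    (and hκ θ ψ).Realize M v ↔ θ.Realize M v ∧ ψ.Realize M v := by
  simp [and, Realize, and_comm]

@[simp]
theorem realize_imp (hκ : ℵ₀ < κ) (θ ψ : QFormula L κ n) (v : Fin n → M) :
    (imp hκ θ ψ).Realize M v ↔ (θ.Realize M v → ψ.Realize M v) := by
  simp [imp, Realize, imp_iff_or_not]

theorem realize_alls (k : ℕ) (θ : QFormula L κ (n + k)) (v : Fin n → M) :
    (alls k θ).Realize M v ↔ ∀ w : Fin k → M, θ.Realize M (Fin.append v w) := by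
  induction k with
  | zero =>
    have (w : Fin 0 → M) : Fin.append v w = v := by
      rw [Subsingleton.elim w Fin.elim0]; exact Fin.append_elim0 v
    simp [alls, this]
  | succ k ih =>
    rw [alls, ih]
    simp only [Realize]
    constructor
    · intro h w
      have := h (Fin.init w) (w (Fin.last k))
      rwa [← Fin.append_snoc, Fin.snoc_init_self] at this
    · intro h w x
      rw [← Fin.append_snoc]
      exact h _

theorem realize_close (k : ℕ) (θ : QFormula L κ k) :
    (close k θ).Realize M Fin.elim0 ↔ ∀ w : Fin k → M, θ.Realize M w := by
  induction k with
  | zero =>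
    have (w : Fin 0 → M) : w = Fin.elim0 := Subsingleton.elim _ _
    simp [close, this]
  | succ k ih =>
    rw [close, ih]
    simp only [Realize]
    constructor
    · intro h w
      simpa using h (Fin.init w) (w (Fin.last k))
    · intro h w x
      exact h _

/-! ### Relativization -/

/-- The formula `R(t₀, …, tₘ₋₁, s)`. -/
def relSnoc {m : ℕ} (R : L.Relations (m + 1)) (t : Fin m → L.Term (Fin n)) (s : L.Term (Fin n)) :
    QFormula L κ n :=
  .rel R (Fin.snoc t s)

/-- The formula `R(x_{t 0}, …, x_{t (m - 1)}, xₙ)`. -/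
def guard {m : ℕ} (R : L.Relations (m + 1)) (t : Fin m → Fin n) : QFormula L κ (n + 1) :=
  relSnoc R (fun i => Term.var (t i).castSucc) (Term.var (Fin.last n))

/-- The relativization of a formula to the set defined by `guard R t`: all quantifiers are
restricted to that set. -/
def relativize (hκ : ℵ₀ < κ) {m : ℕ} (R : L.Relations (m + 1)) :
    {n : ℕ} → QFormula L κ n → (Fin m → Fin n) → QFormula L κ n
  | _, .eq s t, _ => .eq s t
  | _, .rel R' ts, _ => .rel R' ts
  | _, .not θ, t => .not (relativize hκ R θ t)
  | _, .conj ι hι θ, t => .conj ι hι fun i => relativize hκ R (θ i) t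
  | _, .disj ι hι θ, t => .disj ι hι fun i => relativize hκ R (θ i) t
  | _, .all θ, t => .all (imp hκ (guard R t) (relativize hκ R θ fun i => (t i).castSucc))
  | _, .ex θ, t => .ex (and hκ (guard R t) (relativize hκ R θ fun i => (t i).castSucc))
  | _, .Q θ, t => .Q (and hκ (guard R t) (relativize hκ R θ fun i => (t i).castSucc))

@[simp]
theorem realize_relSnoc {m : ℕ} (R : L.Relations (m + 1)) (t : Fin m → L.Term (Fin n))
    (s : L.Term (Fin n)) (v : Fin n → M) : (relSnoc R t s : QFormula L κ n).Realize M v ↔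
      Structure.RelMap R
        (Fin.snoc (fun i => (t i).realize v) (s.realize v) : Fin (m + 1) → M) := by
  simp only [relSnoc, Realize]
  refine Eq.to_iff (congrArg _ (funext fun i => ?_))
  induction i using Fin.lastCases <;> simp

@[simp]
theorem realize_guard {m : ℕ} (R : L.Relations (m + 1)) (t : Fin m → Fin n) (v : Fin n → M)
    (y : M) : (guard R t : QFormula L κ (n + 1)).Realize M (Fin.snoc v y) ↔
      Structure.RelMap R (Fin.snoc (v ∘ t) y : Fin (m + 1) → M) := by
  simp only [guard, realize_relSnoc, Term.realize_var, Fin.snoc_castSucc, Fin.snoc_last]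
  rfl

/-- Satisfaction of the relativized formula is satisfaction in the substructure, given here as the
image of an embedding, to which the quantifiers are restricted. -/
theorem realize_relativize (hκ : ℵ₀ < κ) {m : ℕ} (R : L.Relations (m + 1)) {S : Type u}
    [L.Structure S] (e : S ↪[L] M) (a : Fin m → M)
    (ha : ∀ y, Structure.RelMap R (Fin.snoc a y : Fin (m + 1) → M) ↔ y ∈ Set.range e)
    (θ : QFormula L κ n) (t : Fin m → Fin n) (v : Fin n → S) (hv : e ∘ v ∘ t = a) :
    (relativize hκ R θ t).Realize M (e ∘ v) ↔ θ.Realize S v := by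
  induction θ with
  | eq s t' =>
    simp [relativize, Realize, HomClass.realize_term, e.injective.eq_iff]
  | rel R' ts =>
    simp only [relativize, Realize, HomClass.realize_term]
    exact e.map_rel R' _
  | not θ ih => simp [relativize, Realize, ih t v hv]
  | conj ι hι θ ih => simp [relativize, Realize, ih _ t v hv]
  | disj ι hι θ ih => simp [relativize, Realize, ih _ t v hv]
  | all θ ih | ex θ ih =>
    have key (s : S) := ih (fun i => (t i).castSucc) (Fin.snoc v s) (by
      rw [← hv]; funext i; simp)
    simp only [Fin.comp_snoc] at key
    have hv' : (e ∘ v) ∘ t = a := hv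
    simp [relativize, Realize, hv', ha, key]
  | Q θ ih =>
    have key (s : S) := ih (fun i => (t i).castSucc) (Fin.snoc v s) (by
      rw [← hv]; funext i; simp)
    simp only [Fin.comp_snoc] at key
    have hv' : (e ∘ v) ∘ t = a := hv
    have : {x : M | ((guard R t).and hκ (relativize hκ R θ fun i => (t i).castSucc)).Realize M
        (Fin.snoc (e ∘ v) x)} = e '' {x : S | θ.Realize S (Fin.snoc v x)} := by
      ext x
      simp only [Set.mem_ofPred_eq, realize_and, realize_guard, hv', ha, Set.mem_image]
      constructor
      · rintro ⟨⟨s, rfl⟩, h⟩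
        exact ⟨s, (key s).1 h, rfl⟩
      · rintro ⟨s, h, rfl⟩
        exact ⟨⟨s, rfl⟩, (key s).2 h⟩
    simp only [relativize, Realize, this]
    exact not_congr ⟨Set.countable_of_injective_of_countable_image e.injective.injOn,
      fun h => h.image e⟩

end QFormula

/-! ### Back and forth -/

section BackAndForth

variable {L : FirstOrder.Language.{u, u}}

/-- A set of pairs respects the interpretations of all symbols and equality: it is the graph of a
partial isomorphism, whose domain need not be closed under the functions. -/
structure IsPartialIso {S N : Type u} [L.Structure S] [L.Structure N] (F : Set (S × N)) :
    Prop where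
  eq_iff : ∀ p ∈ F, ∀ q ∈ F, p.1 = q.1 ↔ p.2 = q.2
  rel_iff : ∀ (m : ℕ) (R : L.Relations m) (t : Fin m → S × N), (∀ i, t i ∈ F) →
    (Structure.RelMap R (fun i => (t i).1) ↔ Structure.RelMap R (fun i => (t i).2))
  fun_iff : ∀ (m : ℕ) (f : L.Functions m) (t : Fin m → S × N), (∀ i, t i ∈ F) → ∀ p ∈ F,
    (Structure.funMap f (fun i => (t i).1) = p.1 ↔ Structure.funMap f (fun i => (t i).2) = p.2)

variable {S N : Type u} [L.Structure S] [L.Structure N]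

/-- A partial isomorphism with full domain and range is an isomorphism. -/
theorem IsPartialIso.exists_equiv {F : Set (S × N)} (hF : IsPartialIso (L := L) F)
    (dom : ∀ s, ∃ t, (s, t) ∈ F) (ran : ∀ t, ∃ s, (s, t) ∈ F) :
    ∃ e : S ≃[L] N, ∀ p ∈ F, e p.1 = p.2 := by
  choose f hf using dom
  choose g hg using ran
  refine ⟨⟨⟨f, g, fun s => ?_, fun t => ?_⟩, fun {m} φ x => ?_, fun {m} R x => ?_⟩, fun p hp => ?_⟩
  · exact (hF.eq_iff _ (hg (f s)) _ (hf s)).2 rfl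
  · exact (hF.eq_iff _ (hf (g t)) _ (hg t)).1 rfl
  · exact ((hF.fun_iff m φ (fun i => (x i, f (x i))) (fun i => hf _) _ (hf _)).1 rfl).symm
  · exact (hF.rel_iff m R (fun i => (x i, f (x i))) (fun i => hf _)).symm
  · exact (hF.eq_iff _ (hf p.1) _ hp).1 rfl

/-- The back-and-forth argument for countable structures. -/
theorem exists_equiv_of_backAndForth [Countable S] [Countable N] (B : Set (Set (S × N)))
    (iso : ∀ F ∈ B, IsPartialIso (L := L) F)
    (forth : ∀ F ∈ B, ∀ s, ∃ G ∈ B, F ⊆ G ∧ ∃ t, (s, t) ∈ G)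
    (back : ∀ F ∈ B, ∀ t, ∃ G ∈ B, F ⊆ G ∧ ∃ s, (s, t) ∈ G) {F : Set (S × N)} (hF : F ∈ B) :
    ∃ e : S ≃[L] N, ∀ p ∈ F, e p.1 = p.2 := by
  have := Encodable.ofCountable (S ⊕ N)
  let 𝒟 : S ⊕ N → Order.Cofinal B
    | .inl s => ⟨{G | ∃ t, (s, t) ∈ G.1}, fun G => by
        obtain ⟨G', h, h', h''⟩ := forth G.1 G.2 s
        exact ⟨⟨G', h⟩, h'', h'⟩⟩
    | .inr t => ⟨{G | ∃ s, (s, t) ∈ G.1}, fun G => by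
        obtain ⟨G', h, h', h''⟩ := back G.1 G.2 t
        exact ⟨⟨G', h⟩, h'', h'⟩⟩
  let q := Order.sequenceOfCofinals (⟨F, hF⟩ : B) 𝒟
  have hq : Monotone q := Order.sequenceOfCofinals.monotone _ _
  -- Finitely many pairs of the union lie in one member of the sequence.
  have fin {m : ℕ} (t : Fin m → S × N) (ht : ∀ i, t i ∈ ⋃ j, (q j).1) :
      ∃ j, ∀ i, t i ∈ (q j).1 := by
    choose j hj using fun i => Set.mem_iUnion.1 (ht i)
    exact ⟨Finset.univ.sup j, fun i => hq (Finset.le_sup (Finset.mem_univ i)) (hj i)⟩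
  have hU : IsPartialIso (L := L) (⋃ j, (q j).1) := by
    refine ⟨fun p hp p' hp' => ?_, fun m R t ht => ?_, fun m f t ht p hp => ?_⟩
    · obtain ⟨j, hj⟩ := fin ![p, p'] (Fin.forall_fin_two.2 ⟨hp, hp'⟩)
      exact (iso _ (q j).2).eq_iff _ (hj 0) _ (hj 1)
    · obtain ⟨j, hj⟩ := fin t ht
      exact (iso _ (q j).2).rel_iff _ R t hj
    · obtain ⟨j, hj⟩ := fin (Fin.cons p t : Fin (m + 1) → S × N) (Fin.cases hp ht)
      exact (iso _ (q j).2).fun_iff _ f t (fun i => hj i.succ) p (hj 0)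
  obtain ⟨e, he⟩ := hU.exists_equiv
    (fun s => by
      obtain ⟨t, ht⟩ := Order.sequenceOfCofinals.encode_mem (⟨F, hF⟩ : B) 𝒟 (.inl s)
      exact ⟨t, Set.mem_iUnion.2 ⟨_, ht⟩⟩)
    (fun t => by
      obtain ⟨s, hs⟩ := Order.sequenceOfCofinals.encode_mem (⟨F, hF⟩ : B) 𝒟 (.inr t)
      exact ⟨s, Set.mem_iUnion.2 ⟨_, hs⟩⟩)
  exact ⟨e, fun p hp => he p (Set.mem_iUnion.2 ⟨0, hp⟩)⟩

end BackAndForth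

/-! ### Scott formulas -/

section Scott

variable {L : FirstOrder.Language.{u, u}} {κ : Cardinal.{u + 1}} {S : Type u} [L.Structure S]

/-- In a countable structure, every finite tuple has a formula that implies all other formulas true
of it: the conjunction, over all tuples of a different type, of a formula telling them apart. -/
theorem exists_isolating [Countable S] (hκ : ℵ₀ < κ) {k : ℕ} (x : Fin k → S) :
    ∃ φ : QFormula L κ k, φ.Realize S x ∧ ∀ y, φ.Realize S y →
      ∀ ψ : QFormula L κ k, ψ.Realize S x → ψ.Realize S y := by
  have h (y : Fin k → S) : ∃ χ : QFormula L κ k, χ.Realize S x ∧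
      (χ.Realize S y → ∀ ψ : QFormula L κ k, ψ.Realize S x → ψ.Realize S y) := by
    by_cases H : ∃ χ : QFormula L κ k, χ.Realize S x ∧ ¬ χ.Realize S y
    · obtain ⟨χ, h1, h2⟩ := H
      exact ⟨χ, h1, fun h => absurd h h2⟩
    · push Not at H
      exact ⟨.conj PEmpty (QFormula.lift_mk_lt_of_countable hκ _) (fun i => i.elim),
        fun i => i.elim, fun _ => H⟩
  choose χ h1 h2 using h
  exact ⟨.conj (Fin k → S) (QFormula.lift_mk_lt_of_countable hκ _) χ, h1, fun y hy => h2 y (hy y)⟩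

/-- Some formula says of a tuple that it satisfies the same members of a given countable family of
formulas as the tuple `x`. -/
theorem exists_conj_iff {k : ℕ} (hκ : ℵ₀ < κ) (ι : Type u) [Countable ι]
    (α : ι → QFormula L κ k) (x : Fin k → S) :
    ∃ φ : QFormula L κ k, ∀ (N : Type u) [L.Structure N] (y : Fin k → N),
      φ.Realize N y ↔ ∀ i, ((α i).Realize S x ↔ (α i).Realize N y) := by
  classical
  refine ⟨.conj ι (QFormula.lift_mk_lt_of_countable hκ _)
    fun i => if (α i).Realize S x then α i else .not (α i), fun N _ y => ?_⟩
  refine forall_congr' fun i => ?_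
  by_cases h : (α i).Realize S x <;> simp [h, QFormula.Realize]

/-- A formula saying of a tuple `y` that `x i ↦ y i` is a partial isomorphism. -/
theorem exists_diagram [∀ m, Countable (L.Functions m)] [∀ m, Countable (L.Relations m)]
    (hκ : ℵ₀ < κ) {k : ℕ} (x : Fin k → S) :
    ∃ φ : QFormula L κ k, ∀ (N : Type u) [L.Structure N] (y : Fin k → N),
      φ.Realize N y ↔ IsPartialIso (L := L) (Set.range fun i => (x i, y i)) := by
  obtain ⟨φ₁, h₁⟩ := exists_conj_iff (L := L) hκ (ULift.{u} (Fin k × Fin k))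
    (fun i => .eq (.var i.down.1) (.var i.down.2)) x
  obtain ⟨φ₂, h₂⟩ := exists_conj_iff (L := L) hκ (Σ m, L.Relations m × (Fin m → Fin k))
    (fun i => .rel i.2.1 fun j => .var (i.2.2 j)) x
  obtain ⟨φ₃, h₃⟩ := exists_conj_iff (L := L) hκ (Σ m, L.Functions m × (Fin m → Fin k) × Fin k)
    (fun i => .eq (.func i.2.1 fun j => .var (i.2.2.1 j)) (.var i.2.2.2)) x
  refine ⟨φ₁.and hκ (φ₂.and hκ φ₃), fun N _ y => ?_⟩
  simp only [QFormula.realize_and, h₁, h₂, h₃]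
  constructor
  · rintro ⟨h₁, h₂, h₃⟩
    refine ⟨?_, ?_, ?_⟩
    · rintro _ ⟨i, rfl⟩ _ ⟨j, rfl⟩
      exact h₁ ⟨i, j⟩
    · intro m R t ht
      choose i hi using ht
      obtain rfl : (fun j => (x (i j), y (i j))) = t := funext hi
      exact h₂ ⟨m, R, i⟩
    · rintro m f t ht _ ⟨j, rfl⟩
      choose i hi using ht
      obtain rfl : (fun j => (x (i j), y (i j))) = t := funext hi
      exact h₃ ⟨m, f, i, j⟩
  · rintro ⟨h₁, h₂, h₃⟩
    refine ⟨?_, ?_, ?_⟩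
    · rintro ⟨i, j⟩
      exact h₁ _ ⟨i, rfl⟩ _ ⟨j, rfl⟩
    · rintro ⟨m, R, i⟩
      exact h₂ m R (fun j => (x (i j), y (i j))) (fun j => ⟨i j, rfl⟩)
    · rintro ⟨m, f, i, j⟩
      exact h₃ m f (fun j => (x (i j), y (i j))) (fun j => ⟨i j, rfl⟩) _ ⟨j, rfl⟩

/-- Scott's theorem: a tuple in a countable structure is determined, up to isomorphism and among
tuples in countable structures, by one formula. -/
theorem exists_scott [Countable S] [∀ m, Countable (L.Functions m)]
    [∀ m, Countable (L.Relations m)] (hκ : ℵ₀ < κ) {n : ℕ} (s : Fin n → S) :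
    ∃ θ : QFormula L κ n, θ.Realize S s ∧
      ∀ (N : Type u) [L.Structure N] [Countable N] (y : Fin n → N), θ.Realize N y →
        ∃ e : S ≃[L] N, ∀ i, e (s i) = y i := by
  choose φ hφ isol using fun k (x : Fin k → S) => exists_isolating (L := L) hκ x
  choose δ hδ using fun k (x : Fin k → S) => exists_diagram (L := L) hκ x
  -- `η k x` says of a tuple that it satisfies the diagram of `x` and that the isolating formulas of
  -- the one-point extensions of `x` describe its own one-point extensions.
  let η (k : ℕ) (x : Fin k → S) : QFormula L κ k :=
    (δ k x).and hκ <| .and hκ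
      (.conj S (QFormula.lift_mk_lt_of_countable hκ _) fun c => .ex (φ (k + 1) (Fin.snoc x c)))
      (.all (.disj S (QFormula.lift_mk_lt_of_countable hκ _) fun c => φ (k + 1) (Fin.snoc x c)))
  have hη (k : ℕ) (x : Fin k → S) : (η k x).Realize S x := by
    simp only [η, QFormula.realize_and, hδ, QFormula.Realize]
    refine ⟨⟨?_, ?_, ?_⟩, fun c => ⟨c, hφ _ _⟩, fun c => ⟨c, hφ _ _⟩⟩
    · rintro _ ⟨i, rfl⟩ _ ⟨j, rfl⟩
      rfl
    · intro m R t ht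
      choose i hi using ht
      obtain rfl : (fun j => (x (i j), x (i j))) = t := funext hi
      rfl
    · rintro m f t ht _ ⟨j, rfl⟩
      choose i hi using ht
      obtain rfl : (fun j => (x (i j), x (i j))) = t := funext hi
      rfl
  refine ⟨(φ n s).and hκ (.conj (ULift.{u} ℕ) (QFormula.lift_mk_lt_of_countable hκ _) fun k =>
    .conj (Fin k.down → S) (QFormula.lift_mk_lt_of_countable hκ _) fun x =>
      .alls k.down (.imp hκ (φ _ (Fin.append s x)) (η _ (Fin.append s x)))), ?_, ?_⟩
  · simp only [QFormula.realize_and, QFormula.Realize, QFormula.realize_alls, QFormula.realize_imp]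
    exact ⟨hφ _ _, fun k x w hw => isol _ _ _ hw _ (hη _ _)⟩
  · intro N _ _ y hy
    simp only [QFormula.realize_and, QFormula.Realize, QFormula.realize_alls,
      QFormula.realize_imp] at hy
    obtain ⟨hy, hstep⟩ := hy
    have step (k : ℕ) (x : Fin k → S) (w : Fin k → N)
        (hw : (φ _ (Fin.append s x)).Realize N (Fin.append y w)) :
        (η _ (Fin.append s x)).Realize N (Fin.append y w) := hstep ⟨k⟩ x w hw
    simp only [η, QFormula.realize_and, hδ, QFormula.Realize] at step
    have mono {k : ℕ} (x : Fin k → S) (w : Fin k → N) (c : S) (d : N) :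
        (Set.range fun i => (x i, w i)) ⊆
          Set.range fun i => ((Fin.snoc x c : Fin (k + 1) → S) i,
            (Fin.snoc w d : Fin (k + 1) → N) i) := by
      rintro _ ⟨i, rfl⟩
      exact ⟨i.castSucc, by simp⟩
    have last {k : ℕ} (x : Fin k → S) (w : Fin k → N) (c : S) (d : N) :
        (c, d) ∈ Set.range fun i => ((Fin.snoc x c : Fin (k + 1) → S) i,
            (Fin.snoc w d : Fin (k + 1) → N) i) := ⟨Fin.last k, by simp⟩
    have e0 {α : Type u} (v : Fin n → α) : Fin.append v Fin.elim0 = v := Fin.append_elim0 v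
    obtain ⟨e, he⟩ := exists_equiv_of_backAndForth (L := L) (F := Set.range fun i => (s i, y i))
      {F | ∃ (k : ℕ) (x : Fin k → S) (w : Fin k → N),
        (φ _ (Fin.append s x)).Realize N (Fin.append y w) ∧
        F = Set.range fun i => (Fin.append s x i, Fin.append y w i)}
      (by
        rintro _ ⟨k, x, w, hw, rfl⟩
        exact (step k x w hw).1)
      (by
        rintro _ ⟨k, x, w, hw, rfl⟩ c
        obtain ⟨d, hd⟩ := (step k x w hw).2.1 c
        rw [← Fin.append_snoc, ← Fin.append_snoc] at hd
        refine ⟨_, ⟨k + 1, _, _, hd, rfl⟩, ?_, d, ?_⟩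
        · rw [Fin.append_snoc, Fin.append_snoc]
          exact mono _ _ _ _
        · rw [Fin.append_snoc, Fin.append_snoc]
          exact last _ _ _ _)
      (by
        rintro _ ⟨k, x, w, hw, rfl⟩ d
        obtain ⟨c, hc⟩ := (step k x w hw).2.2 d
        rw [← Fin.append_snoc, ← Fin.append_snoc] at hc
        refine ⟨_, ⟨k + 1, _, _, hc, rfl⟩, ?_, c, ?_⟩
        · rw [Fin.append_snoc, Fin.append_snoc]
          exact mono _ _ _ _
        · rw [Fin.append_snoc, Fin.append_snoc]
          exact last _ _ _ _)
      ⟨0, Fin.elim0, Fin.elim0, by rw [e0, e0]; exact hy, by rw [e0, e0]; rfl⟩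
    exact ⟨e, fun i => he _ ⟨i, rfl⟩⟩

end Scott

/-! ### Strong substructures -/

namespace AbstractClass

variable {L : FirstOrder.Language.{u, u}} {K : AbstractClass L} {M N : Type u} [L.Structure M]
  [L.Structure N]

theorem IsAEC.strong_map_equiv_iff (hK : K.IsAEC) (e : M ≃[L] N) (S : L.Substructure M) :
    K.Strong (S.map e.toHom) ↔ K.Strong S := by
  refine ⟨fun h => ?_, hK.strong_iso e S⟩
  have := hK.strong_iso e.symm _ h
  rwa [Substructure.map_map, show e.symm.toHom.comp e.toHom = Hom.id L M from
    Hom.ext fun x => e.symm_apply_apply x, Substructure.map_id] at this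

theorem IsAEC.mem_iso_iff (hK : K.IsAEC) (e : M ≃[L] N) : K.Mem M ↔ K.Mem N :=
  ⟨hK.mem_iso e, hK.mem_iso e.symm⟩

/-- The notion `S ≤ T` does not depend on the ambient structure. -/
theorem IsAEC.strongIn_comap_iff (hK : K.IsAEC) {S T U : L.Substructure N} (hST : S ≤ T)
    (hTU : T ≤ U) :
    K.StrongIn (S.comap U.subtype.toHom) (T.comap U.subtype.toHom) ↔ K.StrongIn S T := by
  let e : T ≃[L] T.comap U.subtype.toHom :=
    { toFun := fun x => ⟨⟨x, hTU x.2⟩, x.2⟩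
      invFun := fun x => ⟨x.1.1, x.2⟩
      left_inv := fun _ => rfl
      right_inv := fun _ => rfl
      map_fun' := fun _ _ => rfl
      map_rel' := fun _ _ => Iff.rfl }
  have : (S.comap U.subtype.toHom).comap (T.comap U.subtype.toHom).subtype.toHom =
      (S.comap T.subtype.toHom).map e.toHom := by
    ext x
    constructor
    · intro hx
      exact ⟨⟨x.1.1, x.2⟩, hx, rfl⟩
    · rintro ⟨y, hy, rfl⟩
      exact hy
  rw [StrongIn, StrongIn, this, hK.strong_map_equiv_iff]
  exact and_congr_left fun _ => ⟨fun _ => hST, fun _ => Substructure.monotone_comap hST⟩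

theorem IsAEC.strongIn_trans (hK : K.IsAEC) {S T U : L.Substructure N} (h : K.StrongIn S T)
    (h' : K.StrongIn T U) : K.StrongIn S U :=
  ⟨h.1.trans h'.1, hK.trans _ _ ((hK.strongIn_comap_iff h.1 h'.1).2 h) h'.2⟩

theorem IsAEC.strong_of_strongIn_top (hK : K.IsAEC) {S : L.Substructure N} (h : K.StrongIn S ⊤) :
    K.Strong S := by
  have := (hK.strong_map_equiv_iff (Substructure.topEquiv (L := L) (M := N)) _).2 h.2
  rwa [show (S.comap (⊤ : L.Substructure N).subtype.toHom).map Substructure.topEquiv.toHom = S from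
    Substructure.map_comap_eq_of_surjective Substructure.topEquiv.surjective S] at this

/-- The union `U` of a chain lies above all members of the chain. -/
theorem IsAEC.strongIn_chain (hK : K.IsAEC) {δ : Ordinal.{u}} (hδ : Order.IsSuccLimit δ)
    (C : Ordinal.{u} → L.Substructure N) (hC : ∀ i j, i ≤ j → j < δ → K.StrongIn (C i) (C j))
    (U : L.Substructure N) (hU : ∀ x : N, x ∈ U ↔ ∃ i < δ, x ∈ C i) {i : Ordinal.{u}}
    (hi : i < δ) : K.StrongIn (C i) U := by
  have hCU {j : Ordinal.{u}} (hj : j < δ) : C j ≤ U := fun x hx => (hU x).2 ⟨j, hj, hx⟩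
  have hmax {j : Ordinal.{u}} (hj : j < δ) : max i j < δ := max_lt hi hj
  -- The chain axiom is about the first member, so the chain is made constant up to `i`.
  have := (hK.chain (M := U) δ hδ (fun j => (C (max i j)).comap U.subtype.toHom)
    (fun j k hjk hk => (hK.strongIn_comap_iff (hC _ _ (max_le_max_left i hjk) (hmax hk)).1
      (hCU (hmax hk))).2 (hC _ _ (max_le_max_left i hjk) (hmax hk)))
    (fun x => by
      obtain ⟨j, hj, hx⟩ := (hU x).1 x.2
      exact ⟨j, hj, (hC j (max i j) (le_max_right _ _) (hmax hj)).1 hx⟩)).2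
  exact ⟨hCU hi, by simpa using this⟩

/-- If all members of a chain lie below `V`, then so does the union `U` of the chain. -/
theorem IsAEC.strongIn_smooth (hK : K.IsAEC) {δ : Ordinal.{u}} (hδ : Order.IsSuccLimit δ)
    (C : Ordinal.{u} → L.Substructure N) (hC : ∀ i j, i ≤ j → j < δ → K.StrongIn (C i) (C j))
    (U V : L.Substructure N) (hU : ∀ x : N, x ∈ U ↔ ∃ i < δ, x ∈ C i)
    (hV : ∀ i < δ, K.StrongIn (C i) V) : K.StrongIn U V := by
  refine ⟨fun x hx => ?_, ?_⟩
  · obtain ⟨i, hi, hx⟩ := (hU x).1 hx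
    exact (hV i hi).1 hx
  · exact hK.smooth δ hδ (fun i => (C i).comap V.subtype.toHom)
      (fun i j hij hj => (hK.strongIn_comap_iff (hC i j hij hj).1 (hV j hj).1).2 (hC i j hij hj))
      (fun i hi => (hV i hi).2) _ (fun x => hU x)

theorem IsAEC.mem_of_strong_range (hK : K.IsAEC) (f : M ↪[L] N) (hf : K.Strong f.toHom.range) :
    K.Mem M :=
  (hK.mem_iso_iff f.equivRange).2 (hK.mem_of_strong _ hf).1

theorem IsAEC.strong_map_iff (hK : K.IsAEC) (f : M ↪[L] N) (hf : K.Strong f.toHom.range)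
    (S : L.Substructure M) : K.Strong (S.map f.toHom) ↔ K.Strong S := by
  have h : (S.map f.toHom).comap f.toHom.range.subtype.toHom = S.map f.equivRange.toHom := by
    ext x
    constructor
    · rintro ⟨y, hy, h⟩
      exact ⟨y, hy, Subtype.ext h⟩
    · rintro ⟨y, hy, rfl⟩
      exact ⟨y, hy, rfl⟩
  have hle : S.map f.toHom ≤ f.toHom.range := Hom.map_le_range
  rw [← hK.strong_map_equiv_iff f.equivRange, ← h]
  exact ⟨fun h => (hK.coherence _ _ hle hf h).2, fun h => hK.trans _ _ ⟨hle, h⟩ hf⟩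

/-! ### The closure operator -/

theorem cl_le {A : Set N} {S : L.Substructure N} (hS : K.Strong S) (hA : A ⊆ S) : K.cl A ≤ S :=
  sInf_le ⟨hS, hA⟩

/-- Closures are absolute between a strong substructure and the whole structure. -/
theorem IsAEC.apply_mem_cl_iff (hK : K.IsAEC) (hI : K.HasIntersections) (f : M ↪[L] N)
    (hf : K.Strong f.toHom.range) (A : Set M) (x : M) : f x ∈ K.cl (f '' A) ↔ x ∈ K.cl A := by
  have hM := hK.mem_of_strong_range f hf
  have hN := (hK.mem_of_strong _ hf).2
  constructor
  · intro h
    obtain ⟨y, hy, hxy⟩ := cl_le ((hK.strong_map_iff f hf _).2 (hI M hM A))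
      (Set.image_mono (K.subset_cl A)) h
    rwa [f.injective hxy] at hy
  · have hle : K.cl (f '' A) ≤ f.toHom.range := cl_le hf (Set.image_subset_range f A)
    have hmap : ((K.cl (f '' A)).comap f.toHom).map f.toHom = K.cl (f '' A) := by
      refine le_antisymm Substructure.map_comap_le fun y hy => ?_
      obtain ⟨z, rfl⟩ := hle hy
      exact ⟨z, hy, rfl⟩
    have hs : K.Strong ((K.cl (f '' A)).comap f.toHom) :=
      (hK.strong_map_iff f hf _).1 (hmap.symm ▸ hI N hN _)
    exact fun h => cl_le hs (fun y hy => K.subset_cl _ ⟨y, hy, rfl⟩) h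

theorem IsAEC.isLST_LS (hK : K.IsAEC) : K.IsLST K.LS := csInf_mem (s := {lam | K.IsLST lam}) hK.lst

theorem IsLST.countable_cl (h : K.IsLST ℵ₀) (hN : K.Mem N) {A : Set N} (hA : A.Countable) :
    (K.cl A : Set N).Countable := by
  obtain ⟨S, hS, hAS, hcard⟩ := h.2 N hN A
  have : #S ≤ ℵ₀ := hcard.trans (by simpa using hA)
  exact (Cardinal.le_aleph0_iff_set_countable.1 this).mono (cl_le hS hAS)

/-! ### Directed systems of strong substructures -/

/-- Initial segments of an enumeration of an infinite set in its initial ordinal are smaller than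
the set. -/
theorem exists_rank (A : Type u) : ∃ g : A → Ordinal.{u}, (∀ x, g x < (#A).ord) ∧
    ∀ i < (#A).ord, #{x | g x < i} < #A := by
  obtain ⟨e⟩ : Nonempty (A ≃ (#A).ord.ToType) := Cardinal.eq.1 (mk_ord_toType _).symm
  refine ⟨fun x => (e x).toOrd, fun x => (e x).toOrd.2, fun i hi => ?_⟩
  have hlt := Cardinal.mk_Iio_lt (Ordinal.ToType.mk ⟨i, hi⟩) (by simp)
  rw [mk_ord_toType] at hlt
  refine lt_of_le_of_lt ?_ hlt
  refine Cardinal.mk_le_of_injective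
    (f := fun x => ⟨e x.1, Ordinal.ToType.mk.symm_apply_lt.1 x.2⟩) fun x y h => ?_
  exact Subtype.ext (e.injective (congrArg Subtype.val h))

section System

variable (C : Finset N → L.Substructure N)

/-- The union of the substructures `C F`, for finite `F ⊆ A`. -/
def hull (A : Set N) : L.Substructure N := ⨆ F : {F : Finset N // (F : Set N) ⊆ A}, C F

/-- A system of substructures, indexed by the finite subsets of the structure, such that `C F`
contains `F` and lies above `C G` for all `G ⊆ C F`. -/
structure IsSystem (K : AbstractClass L) (C : Finset N → L.Substructure N) : Prop where
  subset : ∀ F : Finset N, (F : Set N) ⊆ C F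
  strongIn : ∀ F G : Finset N, (G : Set N) ⊆ C F → K.StrongIn (C G) (C F)

variable {C}

theorem IsSystem.mem_hull (hC : IsSystem K C) {A : Set N} {x : N} :
    x ∈ hull C A ↔ ∃ F : Finset N, (F : Set N) ⊆ A ∧ x ∈ C F := by
  classical
  have : Nonempty {F : Finset N // (F : Set N) ⊆ A} := ⟨⟨∅, by simp⟩⟩
  rw [hull, Substructure.mem_iSup_of_directed]
  · simp
  · rintro ⟨F, hF⟩ ⟨G, hG⟩
    refine ⟨⟨F ∪ G, by simp [hF, hG]⟩, (hC.strongIn _ _ ?_).1, (hC.strongIn _ _ ?_).1⟩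
    · exact (Finset.coe_subset.2 Finset.subset_union_left).trans (hC.subset _)
    · exact (Finset.coe_subset.2 Finset.subset_union_right).trans (hC.subset _)

theorem IsSystem.hull_coe (hC : IsSystem K C) (F : Finset N) : hull C (F : Set N) = C F := by
  ext x
  rw [hC.mem_hull]
  exact ⟨fun ⟨G, hG, hx⟩ => (hC.strongIn F G (hG.trans (hC.subset F))).1 hx,
    fun hx => ⟨F, subset_rfl, hx⟩⟩

theorem IsSystem.hull_univ (hC : IsSystem K C) : hull C Set.univ = ⊤ :=
  eq_top_iff.2 fun x _ => hC.mem_hull.2 ⟨{x}, Set.subset_univ _, hC.subset {x} (by simp)⟩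

/-- Hulls form an increasing system. An infinite set is the union of a continuous chain of smaller
subsets, so that the axioms on chains carry out an induction on the cardinality. -/
theorem IsSystem.strongIn_hull (hK : K.IsAEC) (hC : IsSystem K C) {A B : Set N} (hBA : B ⊆ A) :
    K.StrongIn (hull C B) (hull C A) := by
  induction hc : #A using WellFoundedLT.induction generalizing A B with
  | ind c ih =>
  subst hc
  by_cases hA : A.Finite
  · obtain ⟨F, rfl⟩ := hA.exists_finset_coe
    obtain ⟨G, rfl⟩ := (hA.subset hBA).exists_finset_coe
    rw [hC.hull_coe, hC.hull_coe]
    exact hC.strongIn _ _ (hBA.trans (hC.subset F))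
  have hδ : Order.IsSuccLimit (#A).ord := Cardinal.isSuccLimit_ord
    (Cardinal.infinite_iff.1 (Set.infinite_coe_iff.2 hA))
  obtain ⟨g, hg, hlt⟩ := exists_rank A
  let I (i : Ordinal.{u}) : Set N := Subtype.val '' {x : A | g x < i}
  have hIlt {i : Ordinal.{u}} (hi : i < (#A).ord) : #(I i) < #A :=
    Cardinal.mk_image_le.trans_lt (hlt i hi)
  have hImono {i j : Ordinal.{u}} (hij : i ≤ j) : I i ⊆ I j :=
    Set.image_mono fun x (hx : g x < i) => hx.trans_le hij
  have hIA (i : Ordinal.{u}) : I i ⊆ A := by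
    rintro _ ⟨x, -, rfl⟩
    exact x.2
  -- The hull of a subset of `A` is the union of the hulls of its traces on initial segments.
  have hunion {D : Set N} (hD : D ⊆ A) (x : N) :
      x ∈ hull C D ↔ ∃ i < (#A).ord, x ∈ hull C (D ∩ I i) := by
    constructor
    · intro hx
      obtain ⟨F, hF, hx⟩ := hC.mem_hull.1 hx
      have hFA (y : F) : y.1 ∈ A := hD (hF y.2)
      have hsup : F.attach.sup (fun y => g ⟨y, hFA y⟩) < (#A).ord :=
        (Finset.sup_lt_iff hδ.bot_lt).2 fun y _ => hg _
      refine ⟨_, hδ.succ_lt hsup, hC.mem_hull.2 ⟨F, fun y hy => ⟨hF hy, ⟨y, hD (hF hy)⟩, ?_, rfl⟩,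
        hx⟩⟩
      exact Order.lt_succ_of_le
        (Finset.le_sup (f := fun y : F => g ⟨y, hFA y⟩) (Finset.mem_attach F ⟨y, hy⟩))
    · rintro ⟨i, -, hx⟩
      obtain ⟨F, hF, hx⟩ := hC.mem_hull.1 hx
      exact hC.mem_hull.2 ⟨F, hF.trans Set.inter_subset_left, hx⟩
  have hchain {D : Set N} (i j : Ordinal.{u}) (hij : i ≤ j) (hj : j < (#A).ord) :
      K.StrongIn (hull C (D ∩ I i)) (hull C (D ∩ I j)) :=
    ih _ (((Cardinal.mk_le_mk_of_subset Set.inter_subset_right).trans_lt (hIlt hj)))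
      (Set.inter_subset_inter_right D (hImono hij)) rfl
  refine hK.strongIn_smooth hδ (fun i => hull C (B ∩ I i)) hchain _ _ (hunion hBA) fun i hi => ?_
  refine hK.strongIn_trans (T := hull C (A ∩ I i)) ?_ ?_
  · exact ih _ ((Cardinal.mk_le_mk_of_subset Set.inter_subset_right).trans_lt (hIlt hi))
      (Set.inter_subset_inter_left _ hBA) rfl
  · exact hK.strongIn_chain hδ (fun i => hull C (A ∩ I i)) hchain _ (hunion subset_rfl) hi

theorem IsSystem.strong (hK : K.IsAEC) (hC : IsSystem K C) (F : Finset N) : K.Strong (C F) := by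
  refine hK.strong_of_strongIn_top ?_
  rw [← hC.hull_univ, ← hC.hull_coe F]
  exact hC.strongIn_hull hK (Set.subset_univ _)

end System

/-- If the substructures `C n a`, for finite sequences `a`, contain the members of `a` and satisfy
`C m b ≤ C n a` for all sequences `b` in `C n a`, then they are strong in the whole structure. -/
theorem IsAEC.strong_of_tuples (hK : K.IsAEC) (C : ∀ n : ℕ, (Fin n → N) → L.Substructure N)
    (h₁ : ∀ n (a : Fin n → N) i, a i ∈ C n a)
    (h₂ : ∀ n (a : Fin n → N) m (b : Fin m → N), (∀ i, b i ∈ C n a) → K.StrongIn (C m b) (C n a))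
    (n : ℕ) (a : Fin n → N) : K.Strong (C n a) := by
  classical
  let e (F : Finset N) : Fin F.card → N := fun i => (F.equivFin.symm i : N)
  have he (F : Finset N) : Set.range (e F) = F := by
    ext x
    constructor
    · rintro ⟨i, rfl⟩
      exact (F.equivFin.symm i).2
    · intro hx
      exact ⟨F.equivFin ⟨x, hx⟩, by simp [e]⟩
  have hsub (F : Finset N) : (F : Set N) ⊆ C _ (e F) := by
    rw [← he F]
    rintro _ ⟨i, rfl⟩
    exact h₁ _ _ i
  have hsys : IsSystem K (fun F => C _ (e F)) :=
    ⟨hsub, fun F G hG => h₂ _ _ _ _ fun i => hG (he G ▸ ⟨i, rfl⟩)⟩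
  have hmem := hsys.strong hK (Finset.univ.image a)
  have hi (i : Fin n) : a i ∈ Set.range (e (Finset.univ.image a)) := by
    rw [he]; simp
  convert hmem using 1
  refine le_antisymm (h₂ _ _ _ _ fun i => ?_).1 (h₂ _ _ _ _ fun i => ?_).1
  · exact hsub _ (by simp)
  · have : e (Finset.univ.image a) i ∈ Set.range a := by
      have : e (Finset.univ.image a) i ∈ Set.range (e (Finset.univ.image a)) := ⟨i, rfl⟩
      rw [he] at this
      simpa using this
    obtain ⟨j, hj⟩ := this
    exact hj ▸ h₁ _ _ j

end AbstractClass

/-! ### The expansion by the closure relations -/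

/-- The vocabulary with one relation symbol of each arity `m + 1`. -/
def closureLang : FirstOrder.Language.{u, u} where
  Functions _ := PEmpty
  Relations
    | 0 => PEmpty
    | _ + 1 => PUnit

instance : closureLang.{u}.IsRelational := fun _ => inferInstanceAs (IsEmpty PEmpty)

instance (m : ℕ) : Countable (closureLang.{u}.Relations m) :=
  match m with
  | 0 => inferInstanceAs (Countable PEmpty)
  | _ + 1 => inferInstanceAs (Countable PUnit)

instance : Countable closureLang.{u}.Symbols :=
  inferInstanceAs (Countable ((Σ m, closureLang.{u}.Functions m) ⊕ Σ m, closureLang.{u}.Relations m))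

namespace AbstractClass

variable {L : FirstOrder.Language.{u, u}} {K : AbstractClass L}

/-- The new relation symbol of arity `m + 1`. -/
def clRel (L : FirstOrder.Language.{u, u}) (m : ℕ) : (L.sum closureLang.{u}).Relations (m + 1) :=
  Sum.inr PUnit.unit

/-- The interpretation of the new symbols: `(a, y)` is in the relation when `y` is in the closure
of `a`. -/
abbrev closureStructure (K : AbstractClass L) (M : Type u) [L.Structure M] :
    closureLang.{u}.Structure M where
  funMap f := f.elim
  RelMap {m} _ x :=
    match m with
    | 0 => False
    | m + 1 => x (Fin.last m) ∈ K.cl (Set.range (Fin.init x))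

/-- A member of `K`, expanded by the closure relations. -/
def IsClosureExpansion (K : AbstractClass L) (M : Type u) [L.Structure M]
    [(L.sum closureLang.{u}).Structure M] : Prop :=
  K.Mem M ∧ ∀ (m : ℕ) (a : Fin m → M) (y : M),
    Structure.RelMap (clRel L m) (Fin.snoc a y : Fin (m + 1) → M) ↔ y ∈ K.cl (Set.range a)

/-- The class of all members of `K`, expanded by the closure relations. -/
def closureExpansions (K : AbstractClass L) : StructureClass (L.sum closureLang.{u}) := fun M _ =>
  letI : L.Structure M := (LHom.sumInl : L →ᴸ L.sum closureLang.{u}).reduct M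
  K.IsClosureExpansion M

theorem eq_reduct {L' : FirstOrder.Language.{u, u}} (φ : L →ᴸ L') (M : Type u) [s : L.Structure M]
    [L'.Structure M] [φ.IsExpansionOn M] : s = φ.reduct M := by
  ext m f x
  · exact (φ.map_onFunction f x).symm
  · exact (φ.map_onRelation f x).symm.to_iff

theorem closureExpansions_iff (M : Type u) [L.Structure M] [(L.sum closureLang.{u}).Structure M]
    [h : (LHom.sumInl : L →ᴸ L.sum closureLang.{u}).IsExpansionOn M] :
    K.closureExpansions M ↔ K.IsClosureExpansion M := by
  have := eq_reduct (LHom.sumInl : L →ᴸ L.sum closureLang.{u}) M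
  subst this
  rfl

theorem isClosureExpansion_sumStructure {M : Type u} [L.Structure M] (hM : K.Mem M) :
    letI := K.closureStructure M
    K.IsClosureExpansion M := by
  refine ⟨hM, fun m a y => ?_⟩
  change (Fin.snoc a y : Fin (m + 1) → M) (Fin.last m) ∈
    K.cl (Set.range (Fin.init (Fin.snoc a y : Fin (m + 1) → M))) ↔ _
  simp

theorem IsAEC.strong_range_equiv {M N : Type u} [L.Structure M] [L.Structure N]
    (hK : K.IsAEC) (f : M ≃[L] N) (hN : K.Mem N) :
    K.Strong f.toEmbedding.toHom.range := by
  rw [Hom.range_eq_top.2 f.surjective]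
  exact hK.refl hN

variable {M N : Type u} [L.Structure M] [L.Structure N] [(L.sum closureLang.{u}).Structure M]
  [(L.sum closureLang.{u}).Structure N]
  [(LHom.sumInl : L →ᴸ L.sum closureLang.{u}).IsExpansionOn M]
  [(LHom.sumInl : L →ᴸ L.sum closureLang.{u}).IsExpansionOn N]

/-- A strong embedding preserves the closure relations. -/
theorem IsClosureExpansion.exists_embedding (hK : K.IsAEC) (hI : K.HasIntersections)
    (hM : K.IsClosureExpansion M) (hN : K.IsClosureExpansion N) (f : M ↪[L] N)
    (hf : K.Strong f.toHom.range) :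
    ∃ g : M ↪[L.sum closureLang.{u}] N, ∀ x, g x = f x := by
  refine ⟨⟨f.toEmbedding, fun {m} φ x => ?_, fun {m} R x => ?_⟩, fun _ => rfl⟩
  · rcases φ with φ | φ
    · exact (congrArg f (LHom.map_onFunction LHom.sumInl φ x)).trans
        ((f.map_fun φ x).trans (LHom.map_onFunction LHom.sumInl φ (f ∘ x)).symm)
    · exact φ.elim
  · rcases R with R | R
    · exact (LHom.map_onRelation LHom.sumInl R (f ∘ x)).to_iff.trans
        ((f.map_rel R x).trans (LHom.map_onRelation LHom.sumInl R x).to_iff.symm)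
    · cases m with
      | zero => exact R.elim
      | succ m =>
        obtain ⟨a, y, rfl⟩ : ∃ a y, x = Fin.snoc a y := ⟨_, _, (Fin.snoc_init_self x).symm⟩
        change Structure.RelMap (clRel L m) (f ∘ Fin.snoc a y) ↔
          Structure.RelMap (clRel L m) (Fin.snoc a y : Fin (m + 1) → M)
        rw [Fin.comp_snoc, hN.2, hM.2, Set.range_comp, hK.apply_mem_cl_iff hI f hf]

/-- The class of all closure expansions is functorial. -/
theorem IsAEC.isFunctorialExpansion (hK : K.IsAEC) (hI : K.HasIntersections) :
    IsFunctorialExpansion K LHom.sumInl K.closureExpansions where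
  inclusion := LHom.sumInl_injective
  reduct_mem M _ _ _ h := ((closureExpansions_iff M).1 h).1
  existsUnique_expansion M _ hM := by
    let := K.closureStructure M
    refine ⟨inferInstance, ⟨inferInstance, (closureExpansions_iff M).2
      (isClosureExpansion_sumStructure hM)⟩, fun s ⟨hs, h⟩ => ?_⟩
    have h₁ := ((closureExpansions_iff M).1 h).2
    have h₂ := (isClosureExpansion_sumStructure hM).2
    apply Structure.ext
    · funext m f x
      rcases f with f | f
      · exact hs.map_onFunction f x
      · exact f.elim
    · funext m R x
      rcases R with R | R
      · exact hs.map_onRelation R x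
      · cases m with
        | zero => exact R.elim
        | succ m =>
          obtain ⟨a, y, rfl⟩ : ∃ a y, x = Fin.snoc a y := ⟨_, _, (Fin.snoc_init_self x).symm⟩
          exact propext ((h₁ m a y).trans (h₂ m a y).symm)
  iso M N _ _ _ _ _ _ hM hN f := by
    rw [closureExpansions_iff] at hM hN
    obtain ⟨g, hg⟩ := hM.exists_embedding hK hI hN f.toEmbedding (hK.strong_range_equiv f hN.1)
    have hg' : ⇑g = f := funext hg
    refine ⟨⟨f.toEquiv, fun φ x => ?_, fun R x => ?_⟩, fun _ => rfl⟩
    · have := g.map_fun φ x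
      rwa [hg'] at this
    · have := g.map_rel R x
      rwa [hg'] at this
  mono M N _ _ _ _ _ _ hM hN f hf := by
    rw [closureExpansions_iff] at hM hN
    exact hM.exists_embedding hK hI hN f hf

/-! ### Countable representatives of the classes of `≡` -/

/-- A structure whose universe is a set of natural numbers, with a finite sequence in it. These form
a type in `Type u`, unlike the pairs in the definition of `D`. -/
structure Code (L : FirstOrder.Language.{u, u}) : Type u where
  /-- the universe -/
  S : Set (ULift.{u} ℕ)
  /-- its interpretation of the vocabulary -/
  str : L.Structure S
  /-- the length of the sequence -/
  n : ℕ
  /-- the sequence -/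
  a : Fin n → S

instance (c : Code L) : L.Structure c.S := c.str

/-- The code `c` represents `(a, M)`. -/
def Code.Represents (c : Code L) (K : AbstractClass L) (p : K.Pointed) : Prop :=
  ∃ (h : c.n = p.n) (e : c.S ≃[L] K.cl (Set.range p.a)),
    ∀ i, (e (c.a i) : p.M) = p.a (Fin.cast h i)

theorem exists_code (hLST : K.IsLST ℵ₀) (p : K.Pointed) : ∃ c : Code L, c.Represents K p := by
  have : Countable (K.cl (Set.range p.a)) := hLST.countable_cl p.mem (Set.countable_range p.a)
  obtain ⟨f, hf⟩ := exists_injective_nat (K.cl (Set.range p.a))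
  let e : K.cl (Set.range p.a) ≃ Set.range fun x => ULift.up.{u} (f x) :=
    Equiv.ofInjective _ (ULift.up_injective.comp hf)
  let := e.inducedStructure (L := L)
  refine ⟨⟨_, this, p.n, fun i => e ⟨p.a i, K.subset_cl _ ⟨i, rfl⟩⟩⟩, rfl,
    (e.inducedStructureEquiv (L := L)).symm, fun i => ?_⟩
  exact congrArg Subtype.val (e.symm_apply_apply _)

/-- There is a family of at most `|D(K)|` codes that represent all pairs. -/
theorem exists_codes (hK : K.IsAEC) (hI : K.HasIntersections) (hLST : K.IsLST ℵ₀) :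
    ∃ 𝒞 : Set (Code L), Cardinal.lift.{u + 1} #𝒞 ≤ #K.D ∧ (∀ c ∈ 𝒞, K.Mem c.S) ∧
      ∀ p : K.Pointed, ∃ c ∈ 𝒞, c.Represents K p := by
  choose f hf using fun q : K.D => exists_code hLST (Quotient.out q)
  refine ⟨Set.range f, ?_, ?_, fun p => ?_⟩
  · exact Cardinal.mk_range_le_lift.trans_eq (Cardinal.lift_id'.{u, u + 1} _)
  · rintro _ ⟨q, rfl⟩
    obtain ⟨-, e, -⟩ := hf q
    exact (hK.mem_iso_iff e).2 (hK.mem_of_strong _ (hI _ (Quotient.out q).mem _)).1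
  · let q : K.D := Quotient.mk _ p
    obtain ⟨h, e, he⟩ := hf q
    obtain ⟨h', e', he'⟩ : K.PEquiv (Quotient.out q) p := Quotient.exact (Quotient.out_eq q)
    refine ⟨_, ⟨q, rfl⟩, h.trans h', e'.comp e, fun i => ?_⟩
    have : e ((f q).a i) = ⟨_, K.subset_cl _ ⟨Fin.cast h i, rfl⟩⟩ := Subtype.ext (he i)
    rw [Equiv.comp_apply, this]
    exact he' _

/-! ### Models of the theory of the expanded class -/

/-- The `L_{κ, ω}(Q)`-theory of the class of closure expansions. -/
def closureTheory (K : AbstractClass L) (κ : Cardinal.{u + 1}) :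
    Set (QFormula (L.sum closureLang.{u}) κ 0) :=
  {θ | ∀ (M : Type u) [(L.sum closureLang.{u}).Structure M], K.closureExpansions M →
    θ.Realize M Fin.elim0}


variable {κ : Cardinal.{u + 1}}

/-- A formula that is true of all tuples in closure expansions is true of all tuples in models of the
theory, since its universal closure belongs to the theory. -/
theorem realize_of_isModel {M : Type u} [(L.sum closureLang.{u}).Structure M]
    (hM : IsModel (K.closureTheory κ) M) {n : ℕ} (θ : QFormula (L.sum closureLang.{u}) κ n)
    (hθ : ∀ (N : Type u) [L.Structure N] [(L.sum closureLang.{u}).Structure N]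
      [(LHom.sumInl : L →ᴸ L.sum closureLang.{u}).IsExpansionOn N], K.IsClosureExpansion N →
      ∀ v : Fin n → N, θ.Realize N v) (v : Fin n → M) : θ.Realize M v := by
  refine (QFormula.realize_close n θ).1 (hM _ fun N _ hN => (QFormula.realize_close n θ).2 ?_) v
  let : L.Structure N := (LHom.sumInl : L →ᴸ L.sum closureLang.{u}).reduct N
  exact hθ N hN

section Models

variable {M : Type u} [(L.sum closureLang.{u}).Structure M]

/-- `ClRel a y` says that the pair `(a, y)` is in the closure relation of a structure for the
expanded vocabulary. -/
abbrev ClRel {m : ℕ} (a : Fin m → M) (y : M) : Prop :=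
  Structure.RelMap (clRel L m) (Fin.snoc a y : Fin (m + 1) → M)

theorem clRel_self (hM : IsModel (K.closureTheory κ) M) {n : ℕ} (a : Fin n → M) (i : Fin n) :
    ClRel (L := L) a (a i) := by
  simpa using realize_of_isModel hM (.relSnoc (clRel L n) Term.var (Term.var i))
    (fun N _ _ _ hN v => by
      simpa [hN.2] using K.subset_cl _ (Set.mem_range_self i)) a

theorem clRel_funMap (hκ : ℵ₀ < κ) (hM : IsModel (K.closureTheory κ) M) {n m : ℕ}
    (a : Fin n → M) (f : L.Functions m) (b : Fin m → M) (hb : ∀ i, ClRel (L := L) a (b i)) :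
    ClRel (L := L) a (Structure.funMap (L := L.sum closureLang.{u}) (Sum.inl f) b) := by
  have := realize_of_isModel hM (n := n + m)
    (.imp hκ (.conj (ULift.{u} (Fin m)) (QFormula.lift_mk_lt_of_countable hκ _) fun i =>
        .relSnoc (clRel L n) (fun j => .var (Fin.castAdd m j)) (.var (Fin.natAdd n i.down)))
      (.relSnoc (clRel L n) (fun j => .var (Fin.castAdd m j))
        (.func (Sum.inl f) fun i => .var (Fin.natAdd n i))))
    (fun N _ _ _ hN v => by
      simp only [QFormula.realize_imp, QFormula.Realize, QFormula.realize_relSnoc,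
        Term.realize_var, hN.2]
      intro h
      have := (K.cl (Set.range fun j => v (Fin.castAdd m j))).fun_mem f _ fun i => h ⟨i⟩
      rwa [← LHom.map_onFunction (LHom.sumInl : L →ᴸ L.sum closureLang.{u}) f] at this)
    (Fin.append a b)
  simp only [QFormula.realize_imp, QFormula.Realize, QFormula.realize_relSnoc,
    Term.realize_var, Fin.append_left, Fin.append_right] at this
  have h := this fun i => hb i.down
  change ClRel (L := L) a (Structure.funMap (L := L.sum closureLang.{u}) (Sum.inl f) fun i =>
    Fin.append a b (Fin.natAdd n i)) at h
  simpa only [Fin.append_right] using h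

theorem clRel_trans (hI : K.HasIntersections) (hκ : ℵ₀ < κ) (hM : IsModel (K.closureTheory κ) M)
    {n m : ℕ} (a : Fin n → M) (b : Fin m → M) (hb : ∀ i, ClRel (L := L) a (b i)) {y : M}
    (hy : ClRel (L := L) b y) : ClRel (L := L) a y := by
  have := realize_of_isModel hM (n := n + m + 1)
    (.imp hκ (.conj (ULift.{u} (Fin m)) (QFormula.lift_mk_lt_of_countable hκ _) fun i =>
        .relSnoc (clRel L n) (fun j => .var (Fin.castAdd m j).castSucc)
          (.var (Fin.natAdd n i.down).castSucc))
      (.imp hκ (.relSnoc (clRel L m) (fun j => .var (Fin.natAdd n j).castSucc) (.var (Fin.last _)))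
        (.relSnoc (clRel L n) (fun j => .var (Fin.castAdd m j).castSucc) (.var (Fin.last _)))))
    (fun N _ _ _ hN v => by
      simp only [QFormula.realize_imp, QFormula.Realize, QFormula.realize_relSnoc,
        Term.realize_var, hN.2]
      intro h h'
      refine cl_le (hI N hN.1 _) ?_ h'
      rintro _ ⟨i, rfl⟩
      exact h ⟨i⟩)
    (Fin.snoc (Fin.append a b) y)
  simp only [QFormula.realize_imp, QFormula.Realize, QFormula.realize_relSnoc,
    Term.realize_var, Fin.append_left, Fin.append_right, Fin.snoc_castSucc, Fin.snoc_last] at this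
  exact this (fun i => hb i.down) hy

theorem countable_clRel (hLST : K.IsLST ℵ₀) (hM : IsModel (K.closureTheory κ) M) {n : ℕ}
    (a : Fin n → M) : {y | ClRel (L := L) a y}.Countable := by
  have := realize_of_isModel hM (.not (.Q (.guard (clRel L n) id)))
    (fun N _ _ _ hN v => by
      simp only [QFormula.Realize, QFormula.realize_guard, hN.2, not_not]
      exact hLST.countable_cl hN.1 (Set.countable_range v)) a
  simp only [QFormula.Realize, QFormula.realize_guard, not_not] at this
  exact this

/-- The substructure of all elements that the closure relation assigns to `a`. -/
def clSub (hκ : ℵ₀ < κ) (hM : IsModel (K.closureTheory κ) M) {n : ℕ} (a : Fin n → M) :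
    (L.sum closureLang.{u}).Substructure M where
  carrier := {y | ClRel (L := L) a y}
  fun_mem {m} f b hb := by
    rcases f with f | f
    · exact clRel_funMap hκ hM a f b hb
    · exact f.elim

/-- In a model of the theory, the substructure assigned to `a` is isomorphic to a closure
expansion: the theory says that it satisfies the Scott formula of one of at most `|D(K)|` countable
structures. -/
theorem exists_equiv_clSub (hK : K.IsAEC) (hI : K.HasIntersections) (hLST : K.IsLST ℵ₀)
    (hκ : ℵ₀ < κ) (hD : #K.D < κ) (hM : IsModel (K.closureTheory κ) M) {n : ℕ} (a : Fin n → M) :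
    ∃ (S : Type u) (_ : L.Structure S) (_ : (L.sum closureLang.{u}).Structure S)
      (_ : (LHom.sumInl : L →ᴸ L.sum closureLang.{u}).IsExpansionOn S),
      K.IsClosureExpansion S ∧ Nonempty (S ≃[L.sum closureLang.{u}] clSub hκ hM a) := by
  obtain ⟨𝒞, h𝒞, hmem, hrep⟩ := exists_codes hK hI hLST
  let (c : Code L) : closureLang.{u}.Structure c.S := K.closureStructure c.S
  have hcard : L.card ≤ ℵ₀ := (self_le_add_right _ _).trans hLST.1
  have : Countable L.Symbols := Cardinal.mk_le_aleph0_iff.1 hcard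
  have (m : ℕ) : Countable (L.Functions m) :=
    Function.Injective.countable (f := fun f => (Sum.inl ⟨m, f⟩ : L.Symbols)) fun f g h => by
      simpa using h
  have (m : ℕ) : Countable (L.Relations m) :=
    Function.Injective.countable (f := fun f => (Sum.inr ⟨m, f⟩ : L.Symbols)) fun f g h => by
      simpa using h
  have (m : ℕ) : Countable ((L.sum closureLang.{u}).Functions m) :=
    inferInstanceAs (Countable (L.Functions m ⊕ PEmpty))
  have (m : ℕ) : Countable ((L.sum closureLang.{u}).Relations m) :=
    inferInstanceAs (Countable (L.Relations m ⊕ closureLang.{u}.Relations m))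
  choose θ hθ hscott using fun c : {c : 𝒞 // c.1.n = n} =>
    exists_scott (L := L.sum closureLang.{u}) hκ (c.1.1.a ∘ Fin.cast c.2.symm)
  have hι : Cardinal.lift.{u + 1} #{c : 𝒞 // c.1.n = n} < κ :=
    ((Cardinal.lift_le.2 (Cardinal.mk_subtype_le _)).trans h𝒞).trans_lt hD
  have := realize_of_isModel hM
    (.disj {c : 𝒞 // c.1.n = n} hι fun c => .relativize hκ (clRel L n) (θ c) id)
    (fun N _ _ _ hN v => by
      obtain ⟨c, hc, h, e, he⟩ := hrep ⟨N, hN.1, n, v⟩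
      have hran : ((K.cl (Set.range v)).subtype.comp e.toEmbedding).toHom.range =
          K.cl (Set.range v) := by
        ext y
        exact ⟨fun ⟨z, hz⟩ => hz ▸ (e z).2, fun hy => ⟨e.symm ⟨y, hy⟩, by simp⟩⟩
      obtain ⟨g, hg⟩ := (isClosureExpansion_sumStructure (hmem c hc)).exists_embedding hK hI hN
        ((K.cl (Set.range v)).subtype.comp e.toEmbedding) (by rw [hran]; exact hI N hN.1 _)
      have hgv : g ∘ c.a ∘ Fin.cast h.symm = v := by
        funext i
        exact (hg _).trans (he _)
      refine ⟨⟨⟨c, hc⟩, h⟩, ?_⟩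
      rw [← hgv]
      refine (QFormula.realize_relativize hκ (clRel L n) g v (fun y => ?_) _ id _ hgv).2
        (hθ ⟨⟨c, hc⟩, h⟩)
      rw [hN.2, ← SetLike.mem_coe, ← hran]
      simp [hg])
    a
  obtain ⟨c, hc⟩ := this
  let a' (i : Fin n) : clSub hκ hM a := ⟨a i, clRel_self hM a i⟩
  have : Countable (clSub hκ hM a) := countable_clRel hLST hM a
  have hc' : (θ c).Realize (clSub hκ hM a) a' :=
    (QFormula.realize_relativize hκ (clRel L n) (clSub hκ hM a).subtype a
      (fun y => by rw [Substructure.coe_subtype, Subtype.range_coe]; exact Iff.rfl) (θ c) id a' rfl).1 hc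
  obtain ⟨e, -⟩ := hscott c (clSub hκ hM a) a' hc'
  exact ⟨c.1.1.S, inferInstance, inferInstance, inferInstance,
    isClosureExpansion_sumStructure (hmem _ c.1.2), ⟨e⟩⟩

/-- The models of the theory are the closure expansions. -/
theorem closureExpansions_iff_isModel (hK : K.IsAEC) (hI : K.HasIntersections)
    (hLST : K.IsLST ℵ₀) (hκ : ℵ₀ < κ) (hD : #K.D < κ) :
    K.closureExpansions M ↔ IsModel (K.closureTheory κ) M := by
  refine ⟨fun h θ hθ => hθ M h, fun hM => ?_⟩
  let φ : L →ᴸ L.sum closureLang.{u} := LHom.sumInl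
  let : L.Structure M := φ.reduct M
  refine (closureExpansions_iff M).2 ?_
  let C (n : ℕ) (a : Fin n → M) : L.Substructure M := φ.substructureReduct (clSub hκ hM a)
  have mem_C {n : ℕ} {a : Fin n → M} {y : M} : y ∈ C n a ↔ ClRel (L := L) a y := Iff.rfl
  -- On each of the substructures `C n a`, the relations are the closure relations.
  have hC (n : ℕ) (a : Fin n → M) : K.Mem (C n a) ∧ ∀ (m : ℕ) (b : Fin m → C n a) (y : C n a),
      ClRel (L := L) (fun i => (b i : M)) (y : M) ↔ y ∈ K.cl (Set.range b) := by
    obtain ⟨S, _, _, _, hS, ⟨e⟩⟩ := exists_equiv_clSub hK hI hLST hκ hD hM a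
    let e' : S ≃[L] C n a :=
      { toFun := fun s => ⟨e s, (e s).2⟩
        invFun := fun y => e.symm ⟨y, y.2⟩
        left_inv := fun s => e.symm_apply_apply s
        right_inv := fun y => Subtype.ext (congrArg Subtype.val (e.apply_symm_apply ⟨y.1, y.2⟩))
        map_fun' := fun f x => by
          have := congrArg Subtype.val (e.map_fun (φ.onFunction f) x)
          rw [φ.map_onFunction] at this
          exact Subtype.ext this
        map_rel' := fun R x => by
          refine Iff.trans ?_
            ((e.map_rel (φ.onRelation R) x).trans (φ.map_onRelation R x).to_iff)
          exact Iff.rfl }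
    have hCmem : K.Mem (C n a) := hK.mem_iso e' hS.1
    refine ⟨hCmem, fun m b y => ?_⟩
    obtain ⟨z, rfl⟩ := e'.surjective y
    obtain ⟨d, rfl⟩ : ∃ d : Fin m → S, b = e' ∘ d :=
      ⟨e'.symm ∘ b, funext fun i => (e'.apply_symm_apply _).symm⟩
    rw [Set.range_comp]
    refine Iff.trans ?_ (hK.apply_mem_cl_iff hI e'.toEmbedding (hK.strong_range_equiv e' hCmem)
      (Set.range d) z).symm
    rw [← hS.2]
    have := e.map_rel (clRel L m) (Fin.snoc d z)
    rw [Fin.comp_snoc] at this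
    refine Iff.trans (Eq.to_iff ?_) this
    change _ = Structure.RelMap (clRel L m) (Subtype.val ∘ (Fin.snoc (e ∘ d) (e z)))
    rw [Fin.comp_snoc]
    rfl
  have hstrong (n : ℕ) (a : Fin n → M) : K.Strong (C n a) := by
    refine hK.strong_of_tuples C (fun n a i => clRel_self hM a i) (fun n a m b hb => ?_) n a
    refine ⟨fun y hy => clRel_trans hI hκ hM a b hb hy, ?_⟩
    have : (C m b).comap (C n a).subtype.toHom =
        K.cl (Set.range fun i => (⟨b i, hb i⟩ : C n a)) := by
      ext y
      exact (hC n a).2 m (fun i => ⟨b i, hb i⟩) y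
    exact this ▸ hI _ (hC n a).1 _
  have hmem : K.Mem M := (hK.mem_of_strong _ (hstrong 0 Fin.elim0)).2
  refine ⟨hmem, fun n a y => ⟨fun hy => ?_, fun hy => ?_⟩⟩
  · have h := ((hC n a).2 n (fun i => ⟨a i, clRel_self hM a i⟩) ⟨y, hy⟩).1 hy
    have hr : (C n a).subtype.toHom.range = C n a := Substructure.range_subtype _
    rw [← hK.apply_mem_cl_iff hI (C n a).subtype (hr.symm ▸ hstrong n a), ← Set.range_comp] at h
    exact h
  · refine cl_le (hstrong n a) ?_ hy
    rintro _ ⟨i, rfl⟩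
    exact clRel_self hM a i

end Models

end AbstractClass

end AECInter

theorem corollary3p10 (L : FirstOrder.Language.{u, u}) (K : AECInter.AbstractClass L)
    (hK : K.IsAEC) (hInter : K.HasIntersections) (hLS : K.LS = ℵ₀) :
    ∃ (E : FirstOrder.Language.{u, u}) (Kp : AECInter.StructureClass (L.sum E))
      (T : Set (AECInter.QFormula (L.sum E) (ℵ₁ + Order.succ #K.D) 0)),
      E.IsRelational ∧ Countable E.Symbols ∧
      AECInter.IsFunctorialExpansion K FirstOrder.Language.LHom.sumInl Kp ∧
      ∀ (M : Type u) [(L.sum E).Structure M], Kp M ↔ AECInter.IsModel T M := by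
  have hκ : ℵ₀ < ℵ₁ + Order.succ #K.D := aleph0_lt_aleph_one.trans_le (self_le_add_right _ _)
  have hD : #K.D < ℵ₁ + Order.succ #K.D := (Order.lt_succ _).trans_le (self_le_add_left _ _)
  exact ⟨AECInter.closureLang, K.closureExpansions, K.closureTheory _, inferInstance, inferInstance,
    hK.isFunctorialExpansion hInter, fun M _ =>
      AECInter.AbstractClass.closureExpansions_iff_isModel hK hInter (hLS ▸ hK.isLST_LS) hκ hD⟩
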